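/- Let $n\ge 0$ and let $\mathfrak S_n$ be the set of permutations of $[n]=\{1,\dots,n\}$. For $\sigma\in\mathfrak S_n$ let $$\operatorname{cros}\sigma=\#\{(i,j)\in[n]^2:\ i<j\le\sigma(i)<\sigma(j)\ \text{ or }\ i>j>\sigma(i)>\sigma(j)\},$$ $$\operatorname{nest}\sigma=\#\{(i,j)\in[n]^2:\ i<j\le\sigma(j)<\sigma(i)\ \text{ or }\ i>j>\sigma(j)>\sigma(i)\}.$$ Let $\operatorname{drop}\sigma$ be the number of $i\in[n]$ with $i>\sigma(i)$, and $\operatorname{fix}\sigma$ the number of fixed points. Let $\operatorname{cda}\sigma$, $\operatorname{cdd}\sigma$, $\operatorname{cval}\sigma$ be the numbers of $x\in[n]$ that are, respectively, double excedances ($\sigma^{-1}(x)<x<\sigma(x)$), double drops ($\sigma^{-1}(x)>x>\sigma(x)$), and cyclic valleys ($\sigma^{-1}(x)>x$ and $x<\sigma(x)$). Put $$B_n(p,q,t,u,v,w,y)=\sum_{\sigma\in\mathfrak S_n}p^{\operatorname{nest}\sigma}q^{\operatorname{cros}\sigma}t^{\operatorname{drop}\sigma}u^{\operatorname{cda}\sigma}v^{\operatorname{cdd}\sigma}w^{\operatorname{cval}\sigma}y^{\operatorname{fix}\sigma},$$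 and for $k,j\ge0$ let $b_{n,k,j}(p,q)\in\mathbb Z[p,q]$ be the coefficient of $w^ky^j$ in $B_n(p,q,1,0,1,w,y)$. Set $\sigma(0)=0$ and $\sigma(n+1)=n+1$. For $i\in[n]$, the letter $\sigma(i)$ is a valley if $\sigma(i-1)>\sigma(i)<\sigma(i+1)$, and a double ascent if $\sigma(i-1)<\sigma(i)<\sigma(i+1)$; a foremaximum is a double ascent $\sigma(i)$ such that $\sigma(l)<\sigma(i)$ for all $1\le l<i$. Let $(31\text{-}2)\,\sigma$ be the number of pairs $2\le i<j\le n$ with $\sigma(i-1)>\sigma(j)>\sigma(i)$, and $(2\text{-}31)\,\sigma$ the number of pairs $1\le i<j\le n-1$ with $\sigma(j+1)<\sigma(i)<\sigma(j)$. Then $$B_n(p,q,t,u,v,w,y)=\sum_{j=0}^{n}y^j\sum_{k=0}^{\lfloor (n-j)/2\rfloor}b_{n,k,j}(p,q)\,(tw)^k(qu+tv)^{n-j-2k}.$$ Moreover, for all $k,j\ge 0$, the polynomial $b_{n,k,j}(p,q)$ has nonnegative integer coefficients, and $$b_{n,k,j}(p,q)=\sum_{\sigma\in\mathfrak S_{n,k,j}}p^{\operatorname{nest}\sigma}q^{\operatorname{cros}\sigma}=\sum_{\sigma\in\mathfrak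 S^*_{n,k,j}}p^{(2\text{-}31)\,\sigma}q^{(31\text{-}2)\,\sigma},$$ where $\mathfrak S_{n,k,j}$ is the set of $\sigma\in\mathfrak S_n$ with exactly $k$ cyclic valleys, exactly $j$ fixed points and no double excedance, and $\mathfrak S^*_{n,k,j}$ is the set of $\sigma\in\mathfrak S_n$ with exactly $k$ valleys and exactly $j$ double ascents, all of which are foremaxima. In particular, $b_{n,k,0}(p,q)$ is the first sum taken over the derangements with exactly $k$ cyclic valleys and no double excedance, and the second sum taken over the permutations without foremaximum (coderangements) with exactly $k$ valleys and no double ascent. -/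

import Mathlib

/-!
Permutations of `[n] = {1, …, n}` are elements of `Equiv.Perm (Fin n)`; the letter `i` of `[n]`
is the element `i - 1` of `Fin n`.
-/

namespace PermStat

variable {n : ℕ}

/-- Number of crossings: pairs `(i, j)` with `i < j ≤ σ i < σ j` or `i > j > σ i > σ j`. -/
def cros (σ : Equiv.Perm (Fin n)) : ℕ :=
  (Finset.univ.filter fun x : Fin n × Fin n =>
    (x.1 < x.2 ∧ x.2 ≤ σ x.1 ∧ σ x.1 < σ x.2) ∨
      (x.1 > x.2 ∧ x.2 > σ x.1 ∧ σ x.1 > σ x.2)).card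

/-- Number of nestings: pairs `(i, j)` with `i < j ≤ σ j < σ i` or `i > j > σ j > σ i`. -/
def nest (σ : Equiv.Perm (Fin n)) : ℕ :=
  (Finset.univ.filter fun x : Fin n × Fin n =>
    (x.1 < x.2 ∧ x.2 ≤ σ x.2 ∧ σ x.2 < σ x.1) ∨
      (x.1 > x.2 ∧ x.2 > σ x.2 ∧ σ x.2 > σ x.1)).card

/-- Number of drops. -/
def drop (σ : Equiv.Perm (Fin n)) : ℕ :=
  (Finset.univ.filter fun i : Fin n => i > σ i).card

/-- Number of (cyclic) double excedances. -/
def cda (σ : Equiv.Perm (Fin n)) : ℕ :=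
  (Finset.univ.filter fun x : Fin n => σ.symm x < x ∧ x < σ x).card

/-- Number of (cyclic) double drops. -/
def cdd (σ : Equiv.Perm (Fin n)) : ℕ :=
  (Finset.univ.filter fun x : Fin n => σ.symm x > x ∧ x > σ x).card

/-- Number of cyclic valleys. -/
def cvalley (σ : Equiv.Perm (Fin n)) : ℕ :=
  (Finset.univ.filter fun x : Fin n => σ.symm x > x ∧ x < σ x).card

/-- Number of fixed points. -/
def fix (σ : Equiv.Perm (Fin n)) : ℕ :=
  (Finset.univ.filter fun x : Fin n => σ x = x).card

/-- The word `σ(0) σ(1) … σ(n) σ(n+1)` with letters in `{0, …, n + 1}`, where `σ(0) = 0` and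
`σ(n+1) = n + 1`: `word σ i` is the letter `σ(i)` in one-based numbering. -/
def word (σ : Equiv.Perm (Fin n)) (i : ℕ) : ℕ :=
  if h : 1 ≤ i ∧ i ≤ n then (σ ⟨i - 1, by omega⟩ : ℕ) + 1 else i

/-- The letter at position `i` (one-based) is a valley. -/
def IsValley (σ : Equiv.Perm (Fin n)) (i : ℕ) : Prop :=
  word σ (i - 1) > word σ i ∧ word σ i < word σ (i + 1)

/-- The letter at position `i` (one-based) is a double ascent. -/
def IsDoubleAscent (σ : Equiv.Perm (Fin n)) (i : ℕ) : Prop :=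
  word σ (i - 1) < word σ i ∧ word σ i < word σ (i + 1)

/-- The letter at position `i` (one-based) is a foremaximum: a double ascent that is a
left-to-right maximum. -/
def IsForemaximum (σ : Equiv.Perm (Fin n)) (i : ℕ) : Prop :=
  IsDoubleAscent σ i ∧ ∀ j ∈ Finset.Ico 1 i, word σ j < word σ i

instance (σ : Equiv.Perm (Fin n)) (i : ℕ) : Decidable (IsValley σ i) :=
  inferInstanceAs (Decidable (_ ∧ _))

instance (σ : Equiv.Perm (Fin n)) (i : ℕ) : Decidable (IsDoubleAscent σ i) :=
  inferInstanceAs (Decidable (_ ∧ _))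

instance (σ : Equiv.Perm (Fin n)) (i : ℕ) : Decidable (IsForemaximum σ i) :=
  inferInstanceAs (Decidable (_ ∧ _))

/-- Every double ascent is a foremaximum. -/
def DoubleAscentsAreForemaxima (σ : Equiv.Perm (Fin n)) : Prop :=
  ∀ i ∈ Finset.Icc 1 n, IsDoubleAscent σ i → IsForemaximum σ i

instance (σ : Equiv.Perm (Fin n)) : Decidable (DoubleAscentsAreForemaxima σ) :=
  inferInstanceAs (Decidable (∀ i ∈ Finset.Icc 1 n, IsDoubleAscent σ i → IsForemaximum σ i))

/-- Number of valleys. -/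
def valley (σ : Equiv.Perm (Fin n)) : ℕ := ((Finset.Icc 1 n).filter (IsValley σ)).card

/-- Number of double ascents. -/
def da (σ : Equiv.Perm (Fin n)) : ℕ := ((Finset.Icc 1 n).filter (IsDoubleAscent σ)).card

/-- Number of foremaxima. -/
def fmax (σ : Equiv.Perm (Fin n)) : ℕ := ((Finset.Icc 1 n).filter (IsForemaximum σ)).card

/-- The statistic `(31-2)`: pairs `2 ≤ i < j ≤ n` with `σ(i-1) > σ(j) > σ(i)`. -/
def les (σ : Equiv.Perm (Fin n)) : ℕ :=
  ((Finset.Icc 2 n ×ˢ Finset.Icc 2 n).filter fun x =>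
    x.1 < x.2 ∧ word σ (x.1 - 1) > word σ x.2 ∧ word σ x.2 > word σ x.1).card

/-- The statistic `(2-31)`: pairs `1 ≤ i < j ≤ n - 1` with `σ(j+1) < σ(i) < σ(j)`. -/
def ress (σ : Equiv.Perm (Fin n)) : ℕ :=
  ((Finset.Icc 1 (n - 1) ×ˢ Finset.Icc 1 (n - 1)).filter fun x =>
    x.1 < x.2 ∧ word σ (x.2 + 1) < word σ x.1 ∧ word σ x.1 < word σ x.2).card

/-- Permutations with `k` cyclic valleys, `j` fixed points and no double excedance. -/
def cyclicClass (n k j : ℕ) : Finset (Equiv.Perm (Fin n)) :=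
  Finset.univ.filter fun σ => cvalley σ = k ∧ fix σ = j ∧ cda σ = 0

/-- Permutations with `k` valleys and `j` double ascents, all of which are foremaxima. -/
def linearClass (n k j : ℕ) : Finset (Equiv.Perm (Fin n)) :=
  Finset.univ.filter fun σ => valley σ = k ∧ da σ = j ∧
    DoubleAscentsAreForemaxima σ

open Classical in
/-- Derangements with `k` cyclic valleys and no double excedance. -/
noncomputable def derangementClass (n k : ℕ) : Finset (Equiv.Perm (Fin n)) :=
  Finset.univ.filter fun σ => σ ∈ derangements (Fin n) ∧ cvalley σ = k ∧ cda σ = 0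

/-- Coderangements (no foremaximum) with `k` valleys and no double ascent. -/
def coderangementClass (n k : ℕ) : Finset (Equiv.Perm (Fin n)) :=
  Finset.univ.filter fun σ => fmax σ = 0 ∧ valley σ = k ∧ da σ = 0

/-- The polynomial `B_n(p,q,t,u,v,w,y)`, with its variables taken in an arbitrary commutative
ring (for instance as the indeterminates of a polynomial ring). -/
def B {R : Type*} [CommRing R] (n : ℕ) (p q t u v w y : R) : R :=
  ∑ σ : Equiv.Perm (Fin n),
    p ^ nest σ * q ^ cros σ * t ^ drop σ * u ^ cda σ * v ^ cdd σ * w ^ cvalley σ * y ^ fix σ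

/-- The polynomial `b_{n,k,j}(p,q)` in `ℤ[p,q]` (`p = X 0`, `q = X 1`): the coefficient of
`w^k y^j` in `B_n(p,q,1,0,1,w,y)`, computed in `ℤ[p,q][w][y]`. -/
noncomputable def b (n k j : ℕ) : MvPolynomial (Fin 2) ℤ :=
  ((B n (Polynomial.C (Polynomial.C (MvPolynomial.X 0)))
      (Polynomial.C (Polynomial.C (MvPolynomial.X 1))) 1 0 1
      (Polynomial.C Polynomial.X) Polynomial.X :
    Polynomial (Polynomial (MvPolynomial (Fin 2) ℤ))).coeff j).coeff k

end PermStat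

/-! Write `[h]` for `pqNum p q h`. Permutations are coded by labelled Motzkin paths in two ways.

In the cyclic coding the points are scanned from left to right, and the height counts the arcs `i ↦
σ i` with `i < σ i` that are still open; as many are open in the other direction. When an arc
closes, its label is its rank among the open ones. The arcs open outside it give nestings, the
others crossings. Summing over labels (`B_eq_motzkin`), `B_n` becomes a Motzkin sum with weights `w`
(up), `y p^h + (qu + tv)[h]` (level) and `t[h]^2` (down).

In the linear coding the letters are placed in increasing order, and the height counts the blocks
formed so far, apart from one starting the word. The label of a letter counts the `(31-2)` patterns
in which it plays the `2`. When double ascents are required to be foremaxima, the weights are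
`w[h+1]`, `y p^h + [h]` and `[h]` (`sum_lin_eq_motzkin`).

A Motzkin sum from height 0 sees the up weight at `h` and the down weight at `h + 1` only through
their product (`motzkin_gauge`). Hence `B_n` depends on `t, u, v, w` only through `tw` and `qu + tv`
(`B_eq_B_gauge`), and it suffices to expand the case `t = 1, u = 0`, where `n = fix + 2 cval + cdd`
fixes all exponents. The same lemma equates the linear sum with `B_n(p,q,1,0,1,w,y)`
(`B_eq_sum_lin`).

Surjectivity of the codings is not constructed: they are injective, and there are `n!` histories. -/

namespace PermStat

/-! ### Labelled Motzkin paths and their weighted sums -/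

section History

variable {A R : Type*} [CommSemiring R]

/-- The sum of the weights of all histories of length `n` from height `h` to height `0`; the
letters allowed at height `h` are `al h`, and reading `a` there leads to height `nx h a`. -/
def histSum (al : ℕ → Finset A) (nx : ℕ → A → ℕ) (wt : ℕ → A → R) : ℕ → ℕ → R
  | 0, h => if h = 0 then 1 else 0
  | n + 1, h => ∑ a ∈ al h, wt h a * histSum al nx wt n (nx h a)

open Classical in
/-- The histories of length `n` from height `h` to height `0`. -/
noncomputable def hist (al : ℕ → Finset A) (nx : ℕ → A → ℕ) : ℕ → ℕ → Finset (List A)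
  | 0, h => if h = 0 then {[]} else ∅
  | n + 1, h => (al h).biUnion fun a => (hist al nx n (nx h a)).image (List.cons a)

/-- The weight of a history starting at height `h`. -/
def histWeight (nx : ℕ → A → ℕ) (wt : ℕ → A → R) : ℕ → List A → R
  | _, [] => 1
  | h, a :: l => wt h a * histWeight nx wt (nx h a) l

theorem sum_hist (al : ℕ → Finset A) (nx : ℕ → A → ℕ) (wt : ℕ → A → R) (n h : ℕ) :
    ∑ l ∈ hist al nx n h, histWeight nx wt h l = histSum al nx wt n h := by
  classical
  induction n generalizing h with
  | zero =>
    by_cases hh : h = 0 <;> simp [hist, histSum, hh, histWeight]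
  | succ n ih =>
    rw [hist, histSum, Finset.sum_biUnion]
    · refine Finset.sum_congr rfl fun a _ => ?_
      rw [Finset.sum_image (by intro x _ y _ hxy; simpa using hxy), ← ih, Finset.mul_sum]
      rfl
    · intro a _ b _ hab
      simp only [Function.onFun, Finset.disjoint_left, Finset.mem_image]
      rintro _ ⟨l, _, rfl⟩ ⟨l', _, h'⟩
      exact hab (by simpa using (List.cons.inj h').1.symm)

theorem card_hist (al : ℕ → Finset A) (nx : ℕ → A → ℕ) (n h : ℕ) :
    (hist al nx n h).card = histSum al nx (fun _ _ => (1 : ℕ)) n h := by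
  have key : ∀ (l : List A) (h : ℕ), histWeight nx (fun _ _ => (1 : ℕ)) h l = 1 := by
    intro l
    induction l with
    | nil => exact fun _ => rfl
    | cons a l ih => intro h; rw [histWeight, ih, mul_one]
  rw [← sum_hist, Finset.card_eq_sum_ones]
  exact Finset.sum_congr rfl fun l _ => (key l h).symm

theorem ofFn_mem_hist (al : ℕ → Finset A) (nx : ℕ → A → ℕ) {n : ℕ} (c : Fin n → A)
    (ht : ℕ → ℕ) (hn : ht n = 0) (hal : ∀ i : Fin n, c i ∈ al (ht i))
    (hnx : ∀ i : Fin n, ht (i + 1) = nx (ht i) (c i)) :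
    List.ofFn c ∈ hist al nx n (ht 0) := by
  classical
  induction n generalizing ht with
  | zero => simp [hist, hn]
  | succ n ih =>
    rw [List.ofFn_succ, hist, Finset.mem_biUnion]
    refine ⟨c 0, hal 0, Finset.mem_image_of_mem _ ?_⟩
    have := ih (fun i => c i.succ) (fun i => ht (i + 1)) hn (fun i => hal i.succ)
      (fun i => hnx i.succ)
    have h1 : ht 1 = nx (ht 0) (c 0) := hnx 0
    rwa [← h1]

theorem histWeight_ofFn (nx : ℕ → A → ℕ) (wt : ℕ → A → R) {n : ℕ} (c : Fin n → A)
    (ht : ℕ → ℕ) (hnx : ∀ i : Fin n, ht (i + 1) = nx (ht i) (c i)) :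
    histWeight nx wt (ht 0) (List.ofFn c) = ∏ i : Fin n, wt (ht i) (c i) := by
  induction n generalizing ht with
  | zero => simp [histWeight]
  | succ n ih =>
    rw [List.ofFn_succ, histWeight, Fin.prod_univ_succ]
    have := ih (fun i => c i.succ) (fun i => ht (i + 1)) (fun i => hnx i.succ)
    congr 1
    have h1 : ht 1 = nx (ht 0) (c 0) := hnx 0
    rw [← h1]
    exact this

/-- If the objects of a finite type are coded injectively by histories, and there are as many
objects as histories, then the weighted sum over the objects is the weighted sum over the
histories. -/
theorem sum_eq_histSum {X : Type*} [Fintype X] (al : ℕ → Finset A) (nx : ℕ → A → ℕ)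
    (wt : ℕ → A → R) {n : ℕ} (c : X → Fin n → A) (ht : X → ℕ → ℕ) (h0 : ∀ x, ht x 0 = 0)
    (hn : ∀ x, ht x n = 0) (hal : ∀ x, ∀ i : Fin n, c x i ∈ al (ht x i))
    (hnx : ∀ x, ∀ i : Fin n, ht x (i + 1) = nx (ht x i) (c x i))
    (hinj : Function.Injective c)
    (hcard : histSum al nx (fun _ _ => (1 : ℕ)) n 0 = Fintype.card X) :
    ∑ x, ∏ i : Fin n, wt (ht x i) (c x i) = histSum al nx wt n 0 := by
  classical
  have hinj' : Function.Injective fun x => List.ofFn (c x) := List.ofFn_injective.comp hinj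
  have himg : Finset.univ.image (fun x => List.ofFn (c x)) = hist al nx n 0 := by
    refine Finset.eq_of_subset_of_card_le ?_ ?_
    · intro l hl
      obtain ⟨x, -, rfl⟩ := Finset.mem_image.1 hl
      have := ofFn_mem_hist al nx (c x) (ht x) (hn x) (hal x) (hnx x)
      rwa [h0 x] at this
    · rw [card_hist, hcard, Finset.card_image_of_injective _ hinj', Finset.card_univ]
  rw [← sum_hist, ← himg, Finset.sum_image hinj'.injOn]
  refine Finset.sum_congr rfl fun x _ => ?_
  rw [← histWeight_ofFn nx wt (c x) (ht x) (hnx x), h0 x]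

/-- The weighted sum over Motzkin paths of length `n` from height `h` to height `0`, where the
steps up, level and down starting at height `h` have weights `a h`, `b h` and `c h`. -/
def motzkin (a b c : ℕ → R) : ℕ → ℕ → R
  | 0, h => if h = 0 then 1 else 0
  | n + 1, h => a h * motzkin a b c n (h + 1) + b h * motzkin a b c n h +
      c h * motzkin a b c n (h - 1)

/-- Along a path from `h` to 0 the ratios `g h / g (h ± 1)` telescope to `g h / g 0`. The hypotheses
avoid division, so `g` may take non-invertible values. As `0 - 1 = 0`, the down weight at 0 has to
vanish. -/
theorem motzkin_gauge (a b c a' c' g : ℕ → R) (h0 : g 0 = 1) (hc : c 0 = 0) (hc' : c' 0 = 0)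
    (ha : ∀ h, a h * g (h + 1) = g h * a' h)
    (hg : ∀ h, c (h + 1) * g h = g (h + 1) * c' (h + 1)) (n h : ℕ) :
    motzkin a b c n h = g h * motzkin a' b c' n h := by
  induction n generalizing h with
  | zero => by_cases hh : h = 0 <;> simp [motzkin, hh, h0]
  | succ n ih =>
    simp only [motzkin, ih, mul_add]
    congr 1
    · congr 1
      · rw [← mul_assoc, ha, mul_assoc]
      · ring
    · cases h with
      | zero => simp [hc, hc']
      | succ h =>
        rw [Nat.add_sub_cancel, ← mul_assoc, hg, mul_assoc]

/-- Supplies the count `n!` at `h = 0`; other starting heights are needed for the induction, which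
reduces to the recurrences of binomial coefficients. -/
theorem motzkin_factorial (n h : ℕ) :
    motzkin (fun h => h + 1) (fun h => 2 * h + 1) (fun h => h) n h =
      n.factorial * n.choose h := by
  induction n generalizing h with
  | zero => cases h <;> simp [motzkin]
  | succ n ih =>
    simp only [motzkin, ih]
    have h3 := Nat.choose_succ_right_eq n h
    cases h with
    | zero => simp [Nat.factorial_succ]; ring
    | succ h =>
      rw [Nat.add_sub_cancel, Nat.factorial_succ, Nat.choose_succ_succ n h]
      have h4 := Nat.choose_succ_right_eq n h
      rcases le_or_gt (h + 1) n with hle | hlt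
      · obtain ⟨k, rfl⟩ := Nat.exists_eq_add_of_le hle
        have e1 : h + 1 + k - (h + 1) = k := by omega
        have e2 : h + 1 + k - h = k + 1 := by omega
        rw [e1] at h3
        rw [e2] at h4
        zify at h3 h4 ⊢
        linear_combination ((h + 1 + k).factorial : ℤ) * h3 +
          ((h + 1 + k).factorial : ℤ) * h4
      · rw [Nat.choose_eq_zero_of_lt hlt, Nat.choose_eq_zero_of_lt (by omega : n < h + 1 + 1)]
        rcases Nat.lt_or_ge n h with h' | h'
        · rw [Nat.choose_eq_zero_of_lt h']; ring
        · obtain rfl : n = h := by omega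
          ring

/-- The `(p, q)`-analogue of `h`. -/
def pqNum (p q : R) (h : ℕ) : R := ∑ r ∈ Finset.range h, p ^ r * q ^ (h - 1 - r)

theorem pqNum_zero (p q : R) : pqNum p q 0 = 0 := by simp [pqNum]

theorem sum_range_pow_mul_pow (p q : R) (h : ℕ) :
    ∑ r ∈ Finset.range h, p ^ (h - 1 - r) * q ^ r = pqNum p q h := by
  rw [pqNum, ← Finset.sum_range_reflect]
  refine Finset.sum_congr rfl fun r hr => ?_
  rw [Finset.mem_range] at hr
  rw [show h - 1 - (h - 1 - r) = r by omega]

end History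

/-! ### Counting by filters -/

section Counting

variable {α : Type*}

/-- Used to compare heights just before and just after a point: the two counts differ in at most one
arc or descent. -/
theorem card_filter_eq_add_ite [DecidableEq α] (s : Finset α) (P Q : α → Prop) [DecidablePred P]
    [DecidablePred Q] (a : α) (h : ∀ i ∈ s, i ≠ a → (P i ↔ Q i)) (hQ : ¬ Q a) :
    (s.filter P).card = (s.filter Q).card + if a ∈ s ∧ P a then 1 else 0 := by
  split_ifs with ha
  · rw [← Finset.card_insert_of_notMem (s := s.filter Q) (a := a) (by simp [hQ])]
    congr 1
    ext i
    simp only [Finset.mem_filter, Finset.mem_insert]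
    by_cases hi : i = a
    · subst hi; simp [ha]
    · simp only [hi, false_or]
      exact and_congr_right fun his => h i his hi
  · rw [add_zero]
    congr 1
    ext i
    simp only [Finset.mem_filter]
    by_cases hi : i = a
    · subst hi; tauto
    · exact and_congr_right fun his => h i his hi

theorem card_filter_disjoint (s : Finset α) (P Q T : α → Prop) [DecidablePred P]
    [DecidablePred Q] [DecidablePred T] (h : ∀ i ∈ s, (T i ↔ P i ∨ Q i))
    (hd : ∀ i ∈ s, P i → ¬ Q i) :
    (s.filter T).card = (s.filter P).card + (s.filter Q).card := by
  classical
  rw [← Finset.card_union_of_disjoint]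
  · congr 1
    ext i
    simp only [Finset.mem_filter, Finset.mem_union]
    have := h i
    tauto
  · exact Finset.disjoint_filter.2 hd

theorem card_filter_prod_fst {β : Type*} (s : Finset α) (t : Finset β) (P : α × β → Prop)
    [DecidablePred P] :
    ((s ×ˢ t).filter P).card = ∑ a ∈ s, (t.filter fun b => P (a, b)).card := by
  simp only [Finset.card_filter, Finset.sum_product]

theorem card_filter_prod_snd {β : Type*} (s : Finset α) (t : Finset β) (P : α × β → Prop)
    [DecidablePred P] :
    ((s ×ˢ t).filter P).card = ∑ b ∈ t, (s.filter fun a => P (a, b)).card := by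
  simp only [Finset.card_filter, Finset.sum_product_right]

theorem eq_of_rank_eq [LinearOrder α] (s : Finset α) {a b : α} (ha : a ∈ s) (hb : b ∈ s)
    (h : (s.filter (· < a)).card = (s.filter (· < b)).card) : a = b := by
  have key : ∀ {a b : α}, a ∈ s → a < b →
      (s.filter (· < a)).card < (s.filter (· < b)).card := by
    intro a b ha hab
    refine Finset.card_lt_card ⟨?_, fun hs => ?_⟩
    · exact Finset.monotone_filter_right s fun i _ hi => hi.trans hab
    · have := hs (Finset.mem_filter.2 ⟨ha, hab⟩)
      simp at this
  rcases lt_trichotomy a b with hab | hab | hab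
  · exact absurd h (key ha hab).ne
  · exact hab
  · exact absurd h (key hb hab).ne'

end Counting

/-! ### The cyclic coding: nestings and crossings -/

section Cyclic

/-- Letters of the histories coding permutations by their cycle structure: cyclic valleys, fixed
points, double excedances, double drops, cyclic peaks. -/
abbrev CycLetter := Unit ⊕ Unit ⊕ ℕ ⊕ ℕ ⊕ (ℕ × ℕ)

/-- The letters allowed at height `h`. -/
def cycAllowed (h : ℕ) : Finset CycLetter :=
  Finset.univ.disjSum (Finset.univ.disjSum ((Finset.range h).disjSum
    ((Finset.range h).disjSum (Finset.range h ×ˢ Finset.range h))))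

/-- The height reached from height `h`. -/
def cycNext (h : ℕ) : CycLetter → ℕ
  | .inl _ => h + 1
  | .inr (.inr (.inr (.inr _))) => h - 1
  | _ => h

/-- The weight of a letter at height `h`. -/
def cycWt {R : Type*} [CommSemiring R] (p q t u v w y : R) (h : ℕ) : CycLetter → R
  | .inl _ => w
  | .inr (.inl _) => y * p ^ h
  | .inr (.inr (.inl r)) => u * (p ^ r * q ^ (h - r))
  | .inr (.inr (.inr (.inl s))) => t * v * (p ^ s * q ^ (h - 1 - s))
  | .inr (.inr (.inr (.inr (r, s)))) => t * (p ^ r * q ^ (h - 1 - r) * (p ^ s * q ^ (h - 1 - s)))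

theorem histSum_cyc {R : Type*} [CommSemiring R] (p q t u v w y : R) (n h : ℕ) :
    histSum cycAllowed cycNext (cycWt p q t u v w y) n h =
      motzkin (fun _ => w) (fun h => y * p ^ h + (q * u + t * v) * pqNum p q h)
        (fun h => t * pqNum p q h ^ 2) n h := by
  induction n generalizing h with
  | zero => rfl
  | succ n ih =>
    have e : ∑ r ∈ Finset.range h, u * (p ^ r * q ^ (h - r)) = q * u * pqNum p q h := by
      rw [pqNum, Finset.mul_sum]
      refine Finset.sum_congr rfl fun r hr => ?_
      rw [Finset.mem_range] at hr
      rw [show h - r = h - 1 - r + 1 by omega]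
      ring
    simp only [histSum, motzkin, cycAllowed, Finset.sum_disjSum, cycWt, cycNext, ih,
      Finset.univ_unique, Finset.sum_singleton, ← Finset.sum_mul, e, Finset.sum_product,
      ← Finset.mul_sum]
    rw [← pqNum]
    ring

/-- With all variables 1, `[h] = h`; the gauge `h!` turns the up and down weights `1, h^2` into `h +
1, h`. -/
theorem histSum_cyc_card (n : ℕ) :
    histSum cycAllowed cycNext (fun _ _ => (1 : ℕ)) n 0 = n.factorial := by
  have e : (fun (_ : ℕ) (_ : CycLetter) => (1 : ℕ)) = cycWt 1 1 1 1 1 1 1 := by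
    funext h a
    rcases a with _ | _ | _ | _ | ⟨_, _⟩ <;> simp [cycWt]
  have e2 : pqNum (1 : ℕ) 1 = fun h => h := by funext h; simp [pqNum]
  rw [e, histSum_cyc, e2, motzkin_gauge _ _ _ (fun h => h + 1) (fun h => h) Nat.factorial]
  · have := motzkin_factorial n 0
    simp only [Nat.choose_zero_right, mul_one] at this
    rw [← this, Nat.factorial_zero, one_mul]
    congr 1
    funext h
    ring
  · rfl
  · simp
  · rfl
  · intro h; simp [Nat.factorial_succ]; ring
  · intro h; simp [Nat.factorial_succ]; ring

variable {n : ℕ}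

/-- The number of arcs `i ↦ σ i` with `i < m ≤ σ i`. -/
def cycHeight (σ : Equiv.Perm (Fin n)) (m : ℕ) : ℕ :=
  (Finset.univ.filter fun i : Fin n => (i : ℕ) < m ∧ m ≤ (σ i : ℕ)).card

/-- A bijection sends as many points upwards across a cut as downwards. -/
theorem cycHeight_symm (σ : Equiv.Perm (Fin n)) (m : ℕ) : cycHeight σ.symm m = cycHeight σ m := by
  have h1 := card_filter_disjoint (Finset.univ : Finset (Fin n))
    (fun i => (i : ℕ) < m ∧ m ≤ (σ i : ℕ)) (fun i => (i : ℕ) < m ∧ (σ i : ℕ) < m)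
    (fun i => (i : ℕ) < m) (by intros; omega) (by intros; omega)
  have h2 := card_filter_disjoint (Finset.univ : Finset (Fin n))
    (fun i => m ≤ (i : ℕ) ∧ (σ i : ℕ) < m) (fun i => (i : ℕ) < m ∧ (σ i : ℕ) < m)
    (fun i => (σ i : ℕ) < m) (by intros; omega) (by intros; omega)
  have h3 : (Finset.univ.filter fun i : Fin n => (σ i : ℕ) < m).card =
      (Finset.univ.filter fun i : Fin n => (i : ℕ) < m).card := by
    simp only [Finset.card_filter]
    exact Equiv.sum_comp σ fun i : Fin n => if (i : ℕ) < m then 1 else 0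
  have h4 : cycHeight σ.symm m =
      (Finset.univ.filter fun i : Fin n => m ≤ (i : ℕ) ∧ (σ i : ℕ) < m).card := by
    simp only [cycHeight, Finset.card_filter]
    rw [← Equiv.sum_comp σ]
    simp only [Equiv.symm_apply_apply, and_comm]
  rw [h4]
  unfold cycHeight
  omega

/-- The number of arcs passing over `x`. -/
def cycOver (σ : Equiv.Perm (Fin n)) (x : Fin n) : ℕ :=
  (Finset.univ.filter fun i : Fin n => i < x ∧ x < σ i).card

theorem cycHeight_eq (σ : Equiv.Perm (Fin n)) (x : Fin n) :
    cycHeight σ x = cycOver σ x + if σ.symm x < x then 1 else 0 := by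
  have := card_filter_eq_add_ite (Finset.univ : Finset (Fin n))
    (fun i => (i : ℕ) < (x : ℕ) ∧ (x : ℕ) ≤ (σ i : ℕ)) (fun i => i < x ∧ x < σ i) (σ.symm x)
    (fun i _ hi => by
      have : σ i ≠ x := fun h => hi (by rw [← h, Equiv.symm_apply_apply])
      simp only [Fin.lt_def, ne_eq, Fin.ext_iff] at this ⊢
      omega) (by simp)
  simpa [cycHeight, cycOver] using this

theorem cycHeight_succ (σ : Equiv.Perm (Fin n)) (x : Fin n) :
    cycHeight σ (x + 1) = cycOver σ x + if x < σ x then 1 else 0 := by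
  have := card_filter_eq_add_ite (Finset.univ : Finset (Fin n))
    (fun i => (i : ℕ) < (x + 1 : ℕ) ∧ (x + 1 : ℕ) ≤ (σ i : ℕ)) (fun i => i < x ∧ x < σ i) x
    (fun i _ hi => by
      simp only [Fin.lt_def, ne_eq, Fin.ext_iff] at hi ⊢
      omega) (by simp)
  simpa [cycHeight, cycOver, Nat.succ_le_iff] using this

theorem cycHeight_eq' (σ : Equiv.Perm (Fin n)) (x : Fin n) :
    cycHeight σ x = cycOver σ.symm x + if σ x < x then 1 else 0 := by
  rw [← cycHeight_symm, cycHeight_eq]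
  rfl

/-- The number of nestings of the arc ending at `x` inside arcs passing over `x`. -/
def cycRank (σ : Equiv.Perm (Fin n)) (x : Fin n) : ℕ :=
  (Finset.univ.filter fun i : Fin n => i < σ.symm x ∧ x < σ i).card

/-- The number of crossings `i < j ≤ σ i < σ j` with `σ i = x`. -/
def cycCrosUp (σ : Equiv.Perm (Fin n)) (x : Fin n) : ℕ :=
  (Finset.univ.filter fun j : Fin n => σ.symm x < j ∧ j ≤ x ∧ x < σ j).card

/-- The number of crossings `i > j > σ i > σ j` with `j = x`. -/
def cycCrosLow (σ : Equiv.Perm (Fin n)) (x : Fin n) : ℕ :=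
  (Finset.univ.filter fun y : Fin n => σ x < y ∧ y < x ∧ x < σ.symm y).card

/-- Each nesting is charged to the larger endpoint of its inner arc; a fixed point counts as an
upper arc. -/
theorem nest_eq_sum (σ : Equiv.Perm (Fin n)) :
    nest σ = ∑ x, ((if σ.symm x ≤ x then cycRank σ x else 0) +
      if σ x < x then cycRank σ.symm x else 0) := by
  rw [nest, card_filter_disjoint _
    (fun x : Fin n × Fin n => x.1 < x.2 ∧ x.2 ≤ σ x.2 ∧ σ x.2 < σ x.1)
    (fun x : Fin n × Fin n => x.1 > x.2 ∧ x.2 > σ x.2 ∧ σ x.2 > σ x.1) _ (fun _ _ => Iff.rfl)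
    (fun i _ h h' => lt_asymm h.1 h'.1), Finset.sum_add_distrib, ← Finset.univ_product_univ,
    card_filter_prod_snd, card_filter_prod_snd]
  congr 1
  · rw [← Equiv.sum_comp σ.symm]
    refine Finset.sum_congr rfl fun x _ => ?_
    split_ifs with h
    · simp only [cycRank, Equiv.apply_symm_apply, h, true_and]
    · simp [h]
  · refine Finset.sum_congr rfl fun x _ => ?_
    split_ifs with h
    · simp only [cycRank, Finset.card_filter]
      refine Eq.trans ?_ (Equiv.sum_comp σ _)
      simp [h, and_comm]
    · simp [h]

/-- Each crossing is charged to the larger endpoint of whichever arc closes first. -/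
theorem cros_eq_sum (σ : Equiv.Perm (Fin n)) :
    cros σ = ∑ x, (cycCrosUp σ x + cycCrosLow σ x) := by
  rw [cros, card_filter_disjoint _
    (fun x : Fin n × Fin n => x.1 < x.2 ∧ x.2 ≤ σ x.1 ∧ σ x.1 < σ x.2)
    (fun x : Fin n × Fin n => x.1 > x.2 ∧ x.2 > σ x.1 ∧ σ x.1 > σ x.2) _ (fun _ _ => Iff.rfl)
    (fun i _ h h' => lt_asymm h.1 h'.1), Finset.sum_add_distrib, ← Finset.univ_product_univ,
    card_filter_prod_fst, card_filter_prod_snd]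
  congr 1
  · rw [← Equiv.sum_comp σ.symm]
    refine Finset.sum_congr rfl fun x _ => ?_
    simp only [cycCrosUp, Equiv.apply_symm_apply]
  · refine Finset.sum_congr rfl fun x _ => ?_
    simp only [cycCrosLow, Finset.card_filter]
    refine Eq.trans ?_ (Equiv.sum_comp σ _)
    refine Finset.sum_congr rfl fun i _ => ?_
    simp only [Equiv.symm_apply_apply]
    congr 1
    simp only [eq_iff_iff, gt_iff_lt]
    tauto

/-- An arc open just after `x` nests the arc closing at `x` or crosses it, according to the side of
`σ.symm x` on which it starts. An arc starting at `x` itself is a crossing, whence the extra factor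
`q` of a double excedance. -/
theorem cycRank_add_cycCrosUp (σ : Equiv.Perm (Fin n)) {x : Fin n} (h : σ.symm x < x) :
    cycRank σ x + cycCrosUp σ x = cycHeight σ (x + 1) := by
  refine (card_filter_disjoint _ _ _ _ (fun i _ => ?_) (fun i _ => ?_)).symm
  · have : x < σ i → i ≠ σ.symm x := fun h h' => by simp [h'] at h
    simp only [Fin.lt_def, Fin.le_def, ne_eq, Fin.ext_iff] at *
    omega
  · simp only [Fin.lt_def]
    omega

theorem cycRank_le (σ : Equiv.Perm (Fin n)) {x : Fin n} (h : σ.symm x ≤ x) :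
    cycRank σ x ≤ cycOver σ x :=
  Finset.card_le_card (Finset.monotone_filter_right _ fun _ _ hi => ⟨hi.1.trans_le h, hi.2⟩)

/-- The lower inequalities are strict, so an arc with an endpoint at `x` contributes nothing, and a
double drop gets no extra `q`. -/
theorem cycRank_symm_add_cycCrosLow (σ : Equiv.Perm (Fin n)) {x : Fin n} (h : σ x < x) :
    cycRank σ.symm x + cycCrosLow σ x = cycOver σ.symm x := by
  refine (card_filter_disjoint _ _ _ _ (fun i _ => ?_) (fun i _ => ?_)).symm
  · have : x < σ.symm i → i ≠ σ x := fun h h' => by simp [h'] at h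
    simp only [Fin.lt_def, ne_eq, Fin.ext_iff, Equiv.symm_symm] at *
    omega
  · simp only [Fin.lt_def, Equiv.symm_symm]
    omega

theorem cycCrosUp_eq_zero (σ : Equiv.Perm (Fin n)) {x : Fin n} (h : x ≤ σ.symm x) :
    cycCrosUp σ x = 0 := by
  rw [cycCrosUp, Finset.card_eq_zero, Finset.filter_eq_empty_iff]
  exact fun i _ hi => absurd (h.trans_lt hi.1) hi.2.1.not_gt

theorem cycCrosLow_eq_zero (σ : Equiv.Perm (Fin n)) {x : Fin n} (h : x ≤ σ x) :
    cycCrosLow σ x = 0 := by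
  rw [cycCrosLow, Finset.card_eq_zero, Finset.filter_eq_empty_iff]
  exact fun i _ hi => absurd (h.trans_lt hi.1) hi.2.1.not_gt

/-- The letter coding the element `x`. -/
def cycCode (σ : Equiv.Perm (Fin n)) (x : Fin n) : CycLetter :=
  if σ.symm x < x then
    if σ x < x then .inr (.inr (.inr (.inr (cycRank σ x, cycRank σ.symm x))))
    else .inr (.inr (.inl (cycRank σ x)))
  else if σ x < x then .inr (.inr (.inr (.inl (cycRank σ.symm x))))
  else if σ x = x then .inr (.inl ())
  else .inl ()

theorem symm_apply_eq_self_iff (σ : Equiv.Perm (Fin n)) (x : Fin n) :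
    σ.symm x = x ↔ σ x = x := by
  rw [Equiv.symm_apply_eq, eq_comm]

theorem cycCode_mem (σ : Equiv.Perm (Fin n)) (x : Fin n) :
    cycCode σ x ∈ cycAllowed (cycHeight σ x) := by
  have h1 := cycHeight_eq σ x
  have h2 := cycHeight_eq' σ x
  have h3 := cycRank_le σ (x := x)
  have h4 := cycRank_le σ.symm (x := x)
  rw [Equiv.symm_symm] at h4
  unfold cycCode
  split_ifs with ha hb hb hc <;>
    simp only [cycAllowed, Finset.inr_mem_disjSum, Finset.inl_mem_disjSum, Finset.mem_range,
      Finset.mem_product, Finset.mem_univ]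
  · have := h3 ha.le
    have := h4 hb.le
    simp only [ha, hb, if_true] at h1 h2
    omega
  · have := h3 ha.le
    simp only [ha, if_true] at h1
    omega
  · have := h4 hb.le
    simp only [hb, if_true] at h2
    omega

theorem cycHeight_succ_eq_next (σ : Equiv.Perm (Fin n)) (x : Fin n) :
    cycHeight σ (x + 1) = cycNext (cycHeight σ x) (cycCode σ x) := by
  have h1 := cycHeight_eq σ x
  have h2 := cycHeight_succ σ x
  have h3 := symm_apply_eq_self_iff σ x
  unfold cycCode
  split_ifs with ha hb hb hc <;> simp only [cycNext] <;>
    simp only [ha, if_true, if_false] at h1 <;> simp only [Fin.lt_def, Fin.ext_iff] at * <;>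
    split_ifs at h2 <;> omega

theorem cycHeight_zero (σ : Equiv.Perm (Fin n)) : cycHeight σ 0 = 0 := by simp [cycHeight]

theorem cycHeight_last (σ : Equiv.Perm (Fin n)) : cycHeight σ n = 0 := by
  rw [cycHeight, Finset.card_eq_zero, Finset.filter_eq_empty_iff]
  intro i _ h
  have := (σ i).isLt
  omega

/-- The arcs below `x` determine the set of tails open at `x`, and `cycRank` is the position of
`σ.symm x` in that set. -/
theorem symm_eq_of_cycRank_eq {σ τ : Equiv.Perm (Fin n)} {x : Fin n}
    (h : ∀ i y, i < x → y < x → (σ i = y ↔ τ i = y)) (hσ : σ.symm x < x) (hτ : τ.symm x < x)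
    (hr : cycRank σ x = cycRank τ x) : σ.symm x = τ.symm x := by
  have hS : ∀ i, i < x → (x ≤ σ i ↔ x ≤ τ i) := by
    intro i hi
    rw [← not_lt, ← not_lt, not_iff_not]
    exact ⟨fun h' => by rwa [(h i _ hi h').1 rfl], fun h' => by rwa [(h i _ hi h').2 rfl]⟩
  have key : ∀ ρ : Equiv.Perm (Fin n), ρ.symm x < x → cycRank ρ x =
      ((Finset.univ.filter fun i => i < x ∧ x ≤ ρ i).filter (· < ρ.symm x)).card := by
    intro ρ hρ
    rw [cycRank, Finset.filter_filter]
    congr 1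
    ext i
    simp only [Finset.mem_filter, Finset.mem_univ, true_and]
    constructor
    · exact fun hi => ⟨⟨hi.1.trans hρ, hi.2.le⟩, hi.1⟩
    · refine fun hi => ⟨hi.2, hi.1.2.lt_of_ne fun he => ?_⟩
      rw [he, Equiv.symm_apply_apply] at hi
      exact lt_irrefl _ hi.2
  have hset : (Finset.univ.filter fun i => i < x ∧ x ≤ σ i) =
      Finset.univ.filter fun i => i < x ∧ x ≤ τ i := by
    ext i
    simp only [Finset.mem_filter, Finset.mem_univ, true_and]
    exact and_congr_right (hS i)
  rw [key σ hσ, key τ hτ, hset] at hr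
  refine eq_of_rank_eq _ ?_ ?_ hr
  · rw [← hset]; simp [hσ]
  · simp [hτ]

theorem cycCode_inj_aux {σ τ : Equiv.Perm (Fin n)} {x : Fin n}
    (h : cycCode σ x = cycCode τ x) :
    (σ.symm x < x ↔ τ.symm x < x) ∧ (σ x < x ↔ τ x < x) ∧ (σ x = x ↔ τ x = x) ∧
      (σ.symm x < x → cycRank σ x = cycRank τ x) ∧
      (σ x < x → cycRank σ.symm x = cycRank τ.symm x) := by
  have h3 := symm_apply_eq_self_iff σ x
  have h4 := symm_apply_eq_self_iff τ x
  unfold cycCode at h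
  split_ifs at h <;> simp only [reduceCtorEq, Sum.inr.injEq, Sum.inl.injEq, Prod.mk.injEq] at h <;>
    grind

/-- By induction on `m`, the codes determine all arcs with both endpoints below `m`: the arcs added
by a new point `x` end at it, start at it or are loops, and each is read off the letter at `x`. -/
theorem cycCode_injective : Function.Injective (cycCode (n := n)) := by
  intro σ τ hc
  have key : ∀ m, m ≤ n → ∀ i y : Fin n, (i : ℕ) < m → (y : ℕ) < m → (σ i = y ↔ τ i = y) := by
    intro m
    induction m with
    | zero => intro _ i y hi; omega
    | succ m ih =>
      intro hm
      have ih := ih (by omega)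
      set x : Fin n := ⟨m, hm⟩ with hx
      have hih : ∀ i y, i < x → y < x → (σ i = y ↔ τ i = y) := fun i y hi hy => ih i y hi hy
      have hih' : ∀ i y, i < x → y < x → (σ.symm i = y ↔ τ.symm i = y) := by
        intro i y hi hy
        rw [Equiv.symm_apply_eq, Equiv.symm_apply_eq, eq_comm, hih y i hy hi, eq_comm]
      obtain ⟨h1, h2, h3, h4, h5⟩ := cycCode_inj_aux (congrFun hc x)
      have hin : σ.symm x < x → σ.symm x = τ.symm x := fun h =>
        symm_eq_of_cycRank_eq hih h (h1.1 h) (h4 h)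
      have hout : σ x < x → σ x = τ x := fun h =>
        symm_eq_of_cycRank_eq hih' h (h2.1 h) (h5 h)
      intro i y hi hy
      have hi' : i < x ∨ i = x := by
        rw [Fin.lt_def, Fin.ext_iff, hx]; simp only; omega
      have hy' : y < x ∨ y = x := by
        rw [Fin.lt_def, Fin.ext_iff, hx]; simp only; omega
      rcases hi' with hi' | hi' <;> rcases hy' with hy' | hy'
      · exact hih i y hi' hy'
      · rw [hy']
        constructor
        · intro h
          have h' : σ.symm x = i := by rw [← h, Equiv.symm_apply_apply]
          have := hin (by rwa [h'])
          rw [← h', this, Equiv.apply_symm_apply]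
        · intro h
          have h' : τ.symm x = i := by rw [← h, Equiv.symm_apply_apply]
          have := hin (h1.2 (by rwa [h']))
          rw [← h', ← this, Equiv.apply_symm_apply]
      · rw [hi']
        constructor
        · intro h
          rw [← hout (by rwa [h]), h]
        · intro h
          rw [hout (h2.2 (by rwa [h])), h]
      · rw [hi', hy', h3]
  ext1 i
  exact ((key n le_rfl i (σ i) i.isLt (σ i).isLt).1 rfl).symm

theorem cyc_weight_eq_prod {R : Type*} [CommRing R] (p q t u v w y : R)
    (σ : Equiv.Perm (Fin n)) :
    p ^ nest σ * q ^ cros σ * t ^ drop σ * u ^ cda σ * v ^ cdd σ * w ^ cvalley σ * y ^ fix σ =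
      ∏ x : Fin n, cycWt p q t u v w y (cycHeight σ x) (cycCode σ x) := by
  rw [nest_eq_sum, cros_eq_sum, drop, cda, cdd, cvalley, fix]
  simp only [Finset.card_filter, ← Finset.prod_pow_eq_pow_sum, ← Finset.prod_mul_distrib]
  refine Finset.prod_congr rfl fun x _ => ?_
  have h1 := cycHeight_eq σ x
  have h2 := cycHeight_succ σ x
  have h2' := cycHeight_eq' σ x
  have h3 := symm_apply_eq_self_iff σ x
  have h4 := cycRank_le σ (x := x)
  have h5 := cycRank_add_cycCrosUp σ (x := x)
  have h6 := cycCrosUp_eq_zero σ (x := x)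
  have h7 := cycRank_symm_add_cycCrosLow σ (x := x)
  have h8 := cycCrosLow_eq_zero σ (x := x)
  rcases lt_trichotomy (σ.symm x) x with ha | ha | ha
  · have hf : σ x ≠ x := fun h => ha.ne (h3.2 h)
    rw [if_pos ha] at h1
    have h5 := h5 ha
    have h4 := h4 ha.le
    rcases lt_or_gt_of_ne hf with hb | hb
    · rw [if_neg hb.not_gt] at h2
      rw [if_pos hb] at h2'
      have h7 := h7 hb
      have e1 : cycCrosUp σ x = cycHeight σ x - 1 - cycRank σ x := by omega
      have e2 : cycCrosLow σ x = cycHeight σ x - 1 - cycRank σ.symm x := by omega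
      simp only [cycCode, ha, ha.le, ha.not_gt, hb, hb.not_gt, hf, e1, e2, if_true, if_false,
        cycWt, and_true, and_false]
      ring
    · rw [if_pos hb] at h2
      have e1 : cycCrosUp σ x = cycHeight σ x - cycRank σ x := by omega
      simp only [cycCode, ha, ha.le, ha.not_gt, hb, hb.not_gt, hf, e1, h8 hb.le, if_true, if_false,
        cycWt, and_true, and_false]
      ring
  · have hf := h3.1 ha
    -- Every arc over a fixed point nests it, which gives the level weight `y * p ^ h`.
    have e : cycRank σ x = cycHeight σ x := by
      rw [h1, if_neg (by simp [ha])]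
      simp only [cycRank, cycOver, ha, add_zero]
    simp only [cycCode, ha, hf, lt_irrefl, le_refl, e, h6 ha.ge, h8 hf.ge, if_true, if_false,
      cycWt, and_false]
    ring
  · have hf : σ x ≠ x := fun h => ha.ne' (h3.2 h)
    rcases lt_or_gt_of_ne hf with hb | hb
    · rw [if_pos hb] at h2'
      have h7 := h7 hb
      have e2 : cycCrosLow σ x = cycHeight σ x - 1 - cycRank σ.symm x := by omega
      simp only [cycCode, ha, ha.not_ge, ha.not_gt, hb, hb.not_gt, hf, e2, h6 ha.le, if_true,
        if_false, cycWt, and_true, and_false]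
      ring
    · simp only [cycCode, ha, ha.not_ge, ha.not_gt, hb, hb.not_gt, hf, h6 ha.le, h8 hb.le, if_true,
        if_false, cycWt, and_true, and_false]
      ring

/-- The weighted sum over permutations as a sum over Motzkin paths. -/
theorem B_eq_motzkin {R : Type*} [CommRing R] (n : ℕ) (p q t u v w y : R) :
    B n p q t u v w y =
      motzkin (fun _ => w) (fun h => y * p ^ h + (q * u + t * v) * pqNum p q h)
        (fun h => t * pqNum p q h ^ 2) n 0 := by
  rw [← histSum_cyc, ← sum_eq_histSum cycAllowed cycNext _ cycCode cycHeight cycHeight_zero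
    cycHeight_last cycCode_mem cycHeight_succ_eq_next cycCode_injective]
  · exact Finset.sum_congr rfl fun σ _ => cyc_weight_eq_prod p q t u v w y σ
  · rw [histSum_cyc_card, Fintype.card_perm, Fintype.card_fin]

end Cyclic

/-! ### The linear coding: the patterns 31-2 and 2-31 -/

section Linear

/-- Letters of the histories coding permutations as words: valleys, double ascents, double
descents, peaks. -/
abbrev LinLetter := ℕ ⊕ ℕ ⊕ ℕ ⊕ ℕ

/-- The letters allowed at height `h`. -/
def linAllowed (h : ℕ) : Finset LinLetter :=
  (Finset.range (h + 1)).disjSum ((Finset.range (h + 1)).disjSum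
    ((Finset.range h).disjSum (Finset.range h)))

/-- The height reached from height `h`. -/
def linNext (h : ℕ) : LinLetter → ℕ
  | .inl _ => h + 1
  | .inr (.inr (.inr _)) => h - 1
  | _ => h

/-- The weight of a letter at height `h`; double ascents that are not foremaxima have
weight `0`. -/
def linWt {R : Type*} [CommSemiring R] (p q w y : R) (h : ℕ) : LinLetter → R
  | .inl r => w * (p ^ (h - r) * q ^ r)
  | .inr (.inl r) => if r = 0 then y * p ^ h else 0
  | .inr (.inr (.inl r)) => p ^ (h - 1 - r) * q ^ r
  | .inr (.inr (.inr r)) => p ^ (h - 1 - r) * q ^ r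

theorem histSum_lin {R : Type*} [CommSemiring R] (p q w y : R) (n h : ℕ) :
    histSum linAllowed linNext (linWt p q w y) n h =
      motzkin (fun h => w * pqNum p q (h + 1)) (fun h => y * p ^ h + pqNum p q h)
        (fun h => pqNum p q h) n h := by
  induction n generalizing h with
  | zero => rfl
  | succ n ih =>
    have e := sum_range_pow_mul_pow p q (h + 1)
    simp only [Nat.add_sub_cancel] at e
    simp only [histSum, motzkin, linAllowed, Finset.sum_disjSum, linWt, linNext, ih,
      ← Finset.sum_mul, e, ← Finset.mul_sum, sum_range_pow_mul_pow, Finset.sum_ite_eq',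
      Finset.mem_range, Nat.succ_pos, if_true]
    ring

theorem histSum_lin_card (n : ℕ) :
    histSum linAllowed linNext (fun _ _ => (1 : ℕ)) n 0 = n.factorial := by
  have key : ∀ n h, histSum linAllowed linNext (fun _ _ => (1 : ℕ)) n h =
      motzkin (fun h => h + 1) (fun h => 2 * h + 1) (fun h => h) n h := by
    intro n
    induction n with
    | zero => intro h; rfl
    | succ n ih =>
      intro h
      simp only [histSum, motzkin, linAllowed, Finset.sum_disjSum, linNext, ih, one_mul,
        Finset.sum_const, Finset.card_range, smul_eq_mul]
      ring
  rw [key, motzkin_factorial, Nat.choose_zero_right, mul_one]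

theorem exists_last_of_not {P : ℕ → Prop} {a b : ℕ} (hab : a ≤ b) (ha : P a) (hb : ¬ P b) :
    ∃ i, a < i ∧ i ≤ b ∧ P (i - 1) ∧ ¬ P i := by
  induction b, hab using Nat.le_induction with
  | base => exact absurd ha hb
  | succ b hab ih =>
    by_cases h : P b
    · exact ⟨b + 1, by omega, le_rfl, by simpa using h, hb⟩
    · obtain ⟨i, h1, h2, h3⟩ := ih h
      exact ⟨i, h1, by omega, h3⟩

variable {n : ℕ}

/-- The one-based position of the letter `x`. -/
def pos (σ : Equiv.Perm (Fin n)) (x : Fin n) : ℕ := (σ.symm x : ℕ) + 1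

theorem pos_pos (σ : Equiv.Perm (Fin n)) (x : Fin n) : 1 ≤ pos σ x := by simp [pos]

theorem pos_le (σ : Equiv.Perm (Fin n)) (x : Fin n) : pos σ x ≤ n := (σ.symm x).isLt

theorem pos_ne (σ : Equiv.Perm (Fin n)) {x y : Fin n} (h : x ≠ y) : pos σ x ≠ pos σ y := by
  intro h'
  simp only [pos, Nat.add_right_cancel_iff] at h'
  exact h (σ.symm.injective (Fin.ext h'))

theorem word_pos (σ : Equiv.Perm (Fin n)) (x : Fin n) : word σ (pos σ x) = x + 1 := by
  have h : 1 ≤ pos σ x ∧ pos σ x ≤ n := ⟨pos_pos σ x, pos_le σ x⟩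
  rw [word, dif_pos h]
  simp [pos]

theorem word_zero (σ : Equiv.Perm (Fin n)) : word σ 0 = 0 := by simp [word]

theorem word_add_one (σ : Equiv.Perm (Fin n)) : word σ (n + 1) = n + 1 := by simp [word]

theorem one_le_word (σ : Equiv.Perm (Fin n)) {i : ℕ} (h : 1 ≤ i) : 1 ≤ word σ i := by
  unfold word
  split_ifs <;> omega

theorem word_le (σ : Equiv.Perm (Fin n)) {i : ℕ} (h : i ≤ n) : word σ i ≤ n := by
  unfold word
  split_ifs with h'
  · exact (σ _).isLt
  · exact h

theorem word_eq_iff (σ : Equiv.Perm (Fin n)) (i : ℕ) (x : Fin n) :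
    word σ i = x + 1 ↔ i = pos σ x := by
  refine ⟨fun h => ?_, fun h => by rw [h, word_pos]⟩
  unfold word at h
  split_ifs at h with h'
  · have : σ ⟨i - 1, by omega⟩ = x := Fin.ext (by omega)
    rw [pos, ← this, Equiv.symm_apply_apply]
    simp only
    omega
  · have := x.isLt
    omega

theorem sum_Icc_eq_sum_pos {M : Type*} [AddCommMonoid M] (σ : Equiv.Perm (Fin n)) (f : ℕ → M) :
    ∑ i ∈ Finset.Icc 1 n, f i = ∑ x : Fin n, f (pos σ x) := by
  have : ∑ i ∈ Finset.Icc 1 n, f i = ∑ i ∈ Finset.range n, f (i + 1) := by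
    refine (Finset.sum_nbij (· + 1) ?_ ?_ ?_ fun _ _ => rfl).symm
    · intro i hi; simp at hi ⊢; omega
    · intro i _ j _ h; simpa using h
    · intro i hi
      simp at hi
      exact ⟨i - 1, by simp; omega, by simp; omega⟩
  rw [this, Finset.sum_range fun i => f (i + 1),
    ← Equiv.sum_comp σ.symm fun i : Fin n => f (i + 1)]
  rfl

/-- The number of descents within the first `N` positions from above `X` to below `X`. -/
def linStrict (σ : Equiv.Perm (Fin n)) (N X : ℕ) : ℕ :=
  ((Finset.Icc 1 N).filter fun i => X < word σ (i - 1) ∧ word σ i < X).card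

/-- The number of maximal blocks of letters at most `m` that start within the first `N`
positions and do not contain the initial letter. -/
def linGaps (σ : Equiv.Perm (Fin n)) (N m : ℕ) : ℕ :=
  ((Finset.Icc 1 N).filter fun i => m < word σ (i - 1) ∧ word σ i ≤ m).card

/-- The only descent counted on the left but not by `linStrict` is the one leaving the letter `x +
1`; in `linGaps_succ` it is the one arriving there. -/
theorem linGaps_eq (σ : Equiv.Perm (Fin n)) (N : ℕ) (x : Fin n) :
    linGaps σ N x = linStrict σ N (x + 1) +
      if pos σ x + 1 ≤ N ∧ word σ (pos σ x + 1) < x + 1 then 1 else 0 := by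
  have := card_filter_eq_add_ite (Finset.Icc 1 N)
    (fun i => (x : ℕ) < word σ (i - 1) ∧ word σ i ≤ x)
    (fun i => (x : ℕ) + 1 < word σ (i - 1) ∧ word σ i < x + 1) (pos σ x + 1)
    (fun i hi hne => by
      have := word_eq_iff σ (i - 1) x
      rw [Finset.mem_Icc] at hi
      omega) (by simp [word_pos])
  rw [linGaps, this, linStrict]
  simp [word_pos]

theorem linGaps_succ (σ : Equiv.Perm (Fin n)) (N : ℕ) (x : Fin n) :
    linGaps σ N (x + 1) = linStrict σ N (x + 1) +
      if pos σ x ≤ N ∧ x + 1 < word σ (pos σ x - 1) then 1 else 0 := by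
  have := card_filter_eq_add_ite (Finset.Icc 1 N)
    (fun i => (x : ℕ) + 1 < word σ (i - 1) ∧ word σ i ≤ x + 1)
    (fun i => (x : ℕ) + 1 < word σ (i - 1) ∧ word σ i < x + 1) (pos σ x)
    (fun i hi hne => by
      have := word_eq_iff σ i x
      omega) (by simp [word_pos])
  rw [linGaps, this, linStrict]
  simp [word_pos, pos_pos]

theorem linGaps_mono (σ : Equiv.Perm (Fin n)) {N N' : ℕ} (h : N ≤ N') (m : ℕ) :
    linGaps σ N m ≤ linGaps σ N' m :=
  Finset.card_le_card (Finset.filter_subset_filter _ (Finset.Icc_subset_Icc_right h))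

/-- A word that is above `m` at `N` and not above it at `N'` has a descent through `m` in between.
-/
theorem linGaps_lt (σ : Equiv.Perm (Fin n)) {N N' m : ℕ} (h : N ≤ N') (h1 : m < word σ N)
    (h2 : word σ N' ≤ m) : linGaps σ N m < linGaps σ N' m := by
  obtain ⟨i, hi1, hi2, hi3, hi4⟩ := exists_last_of_not (P := fun i => m < word σ i) h h1 h2.not_gt
  refine Finset.card_lt_card ⟨Finset.filter_subset_filter _ (Finset.Icc_subset_Icc_right h),
    fun hs => ?_⟩
  have := hs (Finset.mem_filter.2 ⟨Finset.mem_Icc.2 ⟨by omega, hi2⟩, hi3, not_lt.1 hi4⟩)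
  rw [Finset.mem_filter, Finset.mem_Icc] at this
  omega

/-- The number of occurrences of `(31-2)` in which `x` plays the role of `2`. -/
def lesAt (σ : Equiv.Perm (Fin n)) (x : Fin n) : ℕ := linStrict σ (pos σ x) (x + 1)

/-- The number of occurrences of `(2-31)` in which `x` plays the role of `2`. -/
def ressAt (σ : Equiv.Perm (Fin n)) (x : Fin n) : ℕ :=
  ((Finset.Icc 1 n).filter fun i =>
    pos σ x < i ∧ (x : ℕ) + 1 < word σ (i - 1) ∧ word σ i < x + 1).card

/-- A descent straddling the value of `x` forms a `31-2` if it lies to the left of `x`, and a `2-31`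
if it lies to the right. -/
theorem lesAt_add_ressAt (σ : Equiv.Perm (Fin n)) (x : Fin n) :
    lesAt σ x + ressAt σ x = linStrict σ n (x + 1) := by
  have h1 : lesAt σ x = ((Finset.Icc 1 n).filter fun i =>
      i ≤ pos σ x ∧ (x : ℕ) + 1 < word σ (i - 1) ∧ word σ i < x + 1).card := by
    unfold lesAt linStrict
    congr 1
    ext i
    have := pos_le σ x
    simp only [Finset.mem_filter, Finset.mem_Icc]
    omega
  rw [h1]
  exact (card_filter_disjoint _ _ _ _ (by intros; omega) (by intros; omega)).symm

theorem les_eq_sum (σ : Equiv.Perm (Fin n)) : les σ = ∑ x, lesAt σ x := by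
  rw [les, card_filter_prod_snd, Finset.sum_subset (s₂ := Finset.Icc 1 n)
    (Finset.Icc_subset_Icc_left (by omega)), sum_Icc_eq_sum_pos σ]
  · refine Finset.sum_congr rfl fun x _ => ?_
    unfold lesAt linStrict
    congr 1
    ext i
    simp only [Finset.mem_filter, Finset.mem_Icc, word_pos]
    have := pos_le σ x
    have := word_eq_iff σ i x
    -- The convention `σ(0) = 0` excludes a descent ending at position 1, so starting the range at 1
    -- instead of 2 adds nothing.
    have : i = 1 → word σ (i - 1) = 0 := by rintro rfl; exact word_zero σ
    omega
  · intro j hj hj'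
    rw [Finset.card_eq_zero, Finset.filter_eq_empty_iff]
    intro i hi
    simp only [Finset.mem_Icc] at hi hj hj'
    omega

theorem ress_eq_sum (σ : Equiv.Perm (Fin n)) : ress σ = ∑ x, ressAt σ x := by
  rw [ress, card_filter_prod_fst, Finset.sum_subset (s₂ := Finset.Icc 1 n)
    (Finset.Icc_subset_Icc_right (by omega)), sum_Icc_eq_sum_pos σ]
  · refine Finset.sum_congr rfl fun x _ => ?_
    unfold ressAt
    have hp := pos_pos σ x
    -- `ress` indexes a descent by its top, `ressAt` by its bottom.
    refine Finset.card_nbij' (· + 1) (· - 1) ?_ ?_ ?_ ?_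
    · intro i hi
      simp [word_pos] at hi ⊢
      omega
    · intro i hi
      have := word_eq_iff σ (i - 1) x
      simp [word_pos] at hi ⊢
      rw [show i - 1 + 1 = i by omega]
      omega
    · intro i _
      simp
    · intro i hi
      simp at hi ⊢
      omega
  · intro j hj hj'
    rw [Finset.card_eq_zero, Finset.filter_eq_empty_iff]
    intro i hi
    simp only [Finset.mem_Icc] at hi hj hj'
    omega

theorem word_pred_ne (σ : Equiv.Perm (Fin n)) (x : Fin n) : word σ (pos σ x - 1) ≠ x + 1 := by
  have := pos_pos σ x
  rw [ne_eq, word_eq_iff]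
  omega

theorem word_succ_ne (σ : Equiv.Perm (Fin n)) (x : Fin n) : word σ (pos σ x + 1) ≠ x + 1 := by
  rw [ne_eq, word_eq_iff]
  omega

/-- The letter coding the value `x`. -/
def linCode (σ : Equiv.Perm (Fin n)) (x : Fin n) : LinLetter :=
  if x + 1 < word σ (pos σ x - 1) then
    if word σ (pos σ x + 1) < x + 1 then .inr (.inr (.inl (lesAt σ x))) else .inl (lesAt σ x)
  else
    if word σ (pos σ x + 1) < x + 1 then .inr (.inr (.inr (lesAt σ x)))
    else .inr (.inl (lesAt σ x))

theorem linGaps_last_eq (σ : Equiv.Perm (Fin n)) (x : Fin n) :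
    linGaps σ n x = lesAt σ x + ressAt σ x +
      if word σ (pos σ x + 1) < x + 1 then 1 else 0 := by
  rw [linGaps_eq, lesAt_add_ressAt]
  congr 2
  have := pos_le σ x
  have := x.isLt
  simp only [eq_iff_iff, and_iff_right_iff_imp]
  intro h
  -- If `x` is the last letter, the convention `σ(n+1) = n + 1` rules out a descent after it.
  by_contra h'
  rw [show pos σ x = n by omega, word_add_one] at h
  omega

theorem linGaps_last_succ (σ : Equiv.Perm (Fin n)) (x : Fin n) :
    linGaps σ n (x + 1) = lesAt σ x + ressAt σ x +
      if x + 1 < word σ (pos σ x - 1) then 1 else 0 := by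
  rw [linGaps_succ, lesAt_add_ressAt]
  simp [pos_le]

theorem linCode_mem (σ : Equiv.Perm (Fin n)) (x : Fin n) :
    linCode σ x ∈ linAllowed (linGaps σ n x) := by
  have h1 := linGaps_last_eq σ x
  unfold linCode
  split_ifs at h1 ⊢ <;>
    simp only [linAllowed, Finset.inr_mem_disjSum, Finset.inl_mem_disjSum, Finset.mem_range] <;>
    omega

theorem linGaps_succ_eq_next (σ : Equiv.Perm (Fin n)) (x : Fin n) :
    linGaps σ n (x + 1) = linNext (linGaps σ n x) (linCode σ x) := by
  have h1 := linGaps_last_eq σ x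
  have h2 := linGaps_last_succ σ x
  unfold linCode
  split_ifs at h1 h2 ⊢ <;> simp only [linNext] <;> omega

theorem linGaps_zero (σ : Equiv.Perm (Fin n)) : linGaps σ n 0 = 0 := by
  rw [linGaps, Finset.card_eq_zero, Finset.filter_eq_empty_iff]
  intro i hi h
  have := one_le_word σ (Finset.mem_Icc.1 hi).1
  omega

theorem linGaps_last (σ : Equiv.Perm (Fin n)) : linGaps σ n n = 0 := by
  rw [linGaps, Finset.card_eq_zero, Finset.filter_eq_empty_iff]
  intro i hi h
  rw [Finset.mem_Icc] at hi
  have := word_le σ (i := i - 1) (by omega)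
  omega

theorem linGaps_pos_self (σ : Equiv.Perm (Fin n)) (x : Fin n) :
    linGaps σ (pos σ x) x = lesAt σ x := by
  rw [linGaps_eq, if_neg (by omega)]
  rfl

/-- `lesAt σ x` indexes the gap between blocks in which `x` is placed. A smaller letter to the right
of `x` lies in a block that starts after `x`, hence has a larger index. -/
theorem pos_lt_pos_iff (σ : Equiv.Perm (Fin n)) {a x : Fin n} (h : a < x) :
    pos σ a < pos σ x ↔ linGaps σ (pos σ a) x ≤ lesAt σ x := by
  rw [← linGaps_pos_self]
  refine ⟨fun h' => linGaps_mono σ h'.le _, fun h' => ?_⟩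
  by_contra hlt
  refine absurd (linGaps_lt σ (not_lt.1 hlt) ?_ ?_) h'.not_gt
  · rw [word_pos]; omega
  · rw [word_pos]; exact h

theorem linCode_inj_aux {σ τ : Equiv.Perm (Fin n)} {x : Fin n} (h : linCode σ x = linCode τ x) :
    lesAt σ x = lesAt τ x ∧
      (x + 1 < word σ (pos σ x - 1) ↔ x + 1 < word τ (pos τ x - 1)) ∧
      (word σ (pos σ x + 1) < x + 1 ↔ word τ (pos τ x + 1) < x + 1) := by
  unfold linCode at h
  split_ifs at h <;> simp only [reduceCtorEq, Sum.inr.injEq, Sum.inl.injEq] at h <;>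
    refine ⟨h, ?_, ?_⟩ <;> omega

/-- The zero-based position of a letter is the number of letters to its left. -/
theorem eq_of_pos_lt_iff {σ τ : Equiv.Perm (Fin n)}
    (h : ∀ a b, pos σ a < pos σ b ↔ pos τ a < pos τ b) : σ = τ := by
  have key : ∀ (ρ : Equiv.Perm (Fin n)) (a : Fin n),
      (Finset.univ.filter fun b => pos ρ b < pos ρ a).card = ρ.symm a := by
    intro ρ a
    rw [← Fin.card_Iio (ρ.symm a), ← Finset.filter_gt_eq_Iio]
    simp only [Finset.card_filter]
    rw [← Equiv.sum_comp ρ.symm fun i => if i < ρ.symm a then 1 else 0]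
    refine Finset.sum_congr rfl fun b _ => ?_
    simp [pos]
  refine Equiv.symm_bijective.injective (Equiv.ext fun a => Fin.ext ?_)
  rw [← key σ a, ← key τ a]
  simp only [h]

/-- Induction on `m`, carrying the relative order of the letters below `m` and the block index of
each. The label of `x` says in which gap it goes, and the type of letter says which neighbouring
blocks it joins. -/
theorem linCode_injective : Function.Injective (linCode (n := n)) := by
  intro σ τ hc
  have key : ∀ m, m ≤ n → ∀ a b : Fin n, (a : ℕ) < m → (b : ℕ) < m →
      linGaps σ (pos σ a) m = linGaps τ (pos τ a) m ∧
        (pos σ a < pos σ b ↔ pos τ a < pos τ b) := by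
    intro m
    induction m with
    | zero => intro _ a b ha; omega
    | succ m ih =>
      intro hm
      have ih := ih (by omega)
      obtain ⟨x, rfl⟩ : ∃ x : Fin n, (x : ℕ) = m := ⟨⟨m, hm⟩, rfl⟩
      obtain ⟨h1, h2, h3⟩ := linCode_inj_aux (congrFun hc x)
      have hord : ∀ a : Fin n, a < x → (pos σ a < pos σ x ↔ pos τ a < pos τ x) := by
        intro a ha
        rw [pos_lt_pos_iff σ ha, pos_lt_pos_iff τ ha, (ih a a ha ha).1, h1]
      intro a b ha hb
      have hcase : ∀ c : Fin n, (c : ℕ) < x + 1 → c < x ∨ c = x := by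
        intro c hc
        rw [Fin.lt_def, Fin.ext_iff]
        omega
      constructor
      · rcases hcase a ha with ha' | rfl
        · have g1 := linGaps_eq σ (pos σ a) x
          have g2 := linGaps_eq τ (pos τ a) x
          have g3 := (ih a a ha' ha').1
          have g4 := hord a ha'
          have g5 := pos_ne σ ha'.ne
          have g6 := pos_ne τ ha'.ne
          rw [linGaps_succ, linGaps_succ]
          -- Block indices to the right of `x` change according to the blocks joined; both
          -- corrections depend only on the order of `a` and `x` and on the type of `x`.
          have e1 : (pos σ x + 1 ≤ pos σ a ∧ word σ (pos σ x + 1) < x + 1) ↔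
              (pos τ x + 1 ≤ pos τ a ∧ word τ (pos τ x + 1) < x + 1) := by omega
          have e2 : (pos σ x ≤ pos σ a ∧ x + 1 < word σ (pos σ x - 1)) ↔
              (pos τ x ≤ pos τ a ∧ x + 1 < word τ (pos τ x - 1)) := by omega
          simp only [e1] at g1
          simp only [e2]
          omega
        · rw [linGaps_succ, linGaps_succ]
          simp only [le_refl, true_and, h2]
          exact congrArg (· + _) h1
      · rcases hcase a ha with ha' | rfl <;> rcases hcase b hb with hb' | rfl
        · exact (ih a b ha' hb').2
        · exact hord a ha'
        · have g4 := hord b hb'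
          have g5 := pos_ne σ hb'.ne
          have g6 := pos_ne τ hb'.ne
          omega
        · simp
  exact eq_of_pos_lt_iff fun a b => (key n le_rfl a b a.isLt b.isLt).2

theorem isDoubleAscent_pos (σ : Equiv.Perm (Fin n)) (x : Fin n) :
    IsDoubleAscent σ (pos σ x) ↔
      ¬ (x + 1 < word σ (pos σ x - 1)) ∧ ¬ (word σ (pos σ x + 1) < x + 1) := by
  have h1 := word_pred_ne σ x
  have h2 := word_succ_ne σ x
  rw [IsDoubleAscent, word_pos]
  omega

theorem isValley_pos (σ : Equiv.Perm (Fin n)) (x : Fin n) :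
    IsValley σ (pos σ x) ↔
      x + 1 < word σ (pos σ x - 1) ∧ ¬ (word σ (pos σ x + 1) < x + 1) := by
  have h2 := word_succ_ne σ x
  rw [IsValley, word_pos]
  omega

/-- When the letter before `x` is smaller, a larger letter further left forces a descent straddling
`x` in between, that is, a `31-2`. So foremaxima are the double ascents with label 0. -/
theorem forall_word_lt_iff (σ : Equiv.Perm (Fin n)) {x : Fin n}
    (h : word σ (pos σ x - 1) < x + 1) :
    (∀ j ∈ Finset.Ico 1 (pos σ x), word σ j < word σ (pos σ x)) ↔ lesAt σ x = 0 := by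
  rw [lesAt, linStrict, Finset.card_eq_zero, Finset.filter_eq_empty_iff, word_pos]
  have hp := pos_pos σ x
  constructor
  · intro hj i hi hlt
    rw [Finset.mem_Icc] at hi
    rcases Nat.lt_or_ge 1 i with h1 | h1
    · have := hj (i - 1) (Finset.mem_Ico.2 (by omega))
      omega
    · rw [show i - 1 = 0 by omega, word_zero] at hlt
      omega
  · intro hi j hj
    by_contra hlt
    rw [Finset.mem_Ico] at hj
    have hne := word_eq_iff σ j x
    obtain ⟨i, h1, h2, h3, h4⟩ := exists_last_of_not (P := fun i => (x : ℕ) + 1 < word σ i)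
      (a := j) (b := pos σ x - 1) (by omega) (by omega) (by omega)
    have hne' := word_eq_iff σ i x
    exact hi (Finset.mem_Icc.2 ⟨by omega, by omega⟩) ⟨h3, by omega⟩

theorem doubleAscentsAreForemaxima_iff (σ : Equiv.Perm (Fin n)) :
    DoubleAscentsAreForemaxima σ ↔ ∀ x, IsDoubleAscent σ (pos σ x) → lesAt σ x = 0 := by
  constructor
  · intro h x hx
    have := (h (pos σ x) (Finset.mem_Icc.2 ⟨pos_pos σ x, pos_le σ x⟩) hx).2
    refine (forall_word_lt_iff σ ?_).1 this
    rw [← word_pos]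
    exact hx.1
  · intro h i hi hd
    obtain ⟨x, rfl⟩ : ∃ x, pos σ x = i := by
      rw [Finset.mem_Icc] at hi
      refine ⟨σ ⟨i - 1, by omega⟩, ?_⟩
      simp only [pos, Equiv.symm_apply_apply]
      omega
    refine ⟨hd, (forall_word_lt_iff σ ?_).2 (h x hd)⟩
    rw [← word_pos]
    exact hd.1

theorem lin_weight_eq_prod {R : Type*} [CommRing R] (p q w y : R) (σ : Equiv.Perm (Fin n)) :
    (if DoubleAscentsAreForemaxima σ then p ^ ress σ * q ^ les σ * w ^ valley σ * y ^ da σ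
      else 0) = ∏ x : Fin n, linWt p q w y (linGaps σ n x) (linCode σ x) := by
  split_ifs with hD
  · rw [doubleAscentsAreForemaxima_iff] at hD
    rw [les_eq_sum, ress_eq_sum, valley, da]
    simp only [Finset.card_filter, sum_Icc_eq_sum_pos σ, ← Finset.prod_pow_eq_pow_sum,
      ← Finset.prod_mul_distrib]
    refine Finset.prod_congr rfl fun x _ => ?_
    have h1 := linGaps_last_eq σ x
    have hD := hD x
    simp only [isDoubleAscent_pos, isValley_pos] at hD ⊢
    by_cases ha : x + 1 < word σ (pos σ x - 1) <;>
      by_cases hb : word σ (pos σ x + 1) < x + 1 <;>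
      simp only [ha, hb, if_true, if_false, not_true, not_false_iff, and_true, and_false,
        true_implies, add_zero] at h1 hD ⊢ <;>
      simp only [linCode, ha, hb, if_true, if_false, linWt, pow_zero, pow_one, mul_one]
    · rw [show linGaps σ n x - 1 - lesAt σ x = ressAt σ x by omega]
    · rw [show linGaps σ n x - lesAt σ x = ressAt σ x by omega]
      ring
    · rw [show linGaps σ n x - 1 - lesAt σ x = ressAt σ x by omega]
    · rw [hD, show linGaps σ n x = ressAt σ x by omega]
      simp [mul_comm]
  · rw [doubleAscentsAreForemaxima_iff] at hD
    push Not at hD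
    obtain ⟨x, hx, hne⟩ := hD
    rw [isDoubleAscent_pos] at hx
    refine (Finset.prod_eq_zero (Finset.mem_univ x) ?_).symm
    simp only [linCode, hx.1, hx.2, if_false, linWt, hne]

/-- The weighted sum over permutations whose double ascents are foremaxima as a sum over Motzkin
paths. -/
theorem sum_lin_eq_motzkin {R : Type*} [CommRing R] (n : ℕ) (p q w y : R) :
    (∑ σ : Equiv.Perm (Fin n), if DoubleAscentsAreForemaxima σ then
      p ^ ress σ * q ^ les σ * w ^ valley σ * y ^ da σ else 0) =
      motzkin (fun h => w * pqNum p q (h + 1)) (fun h => y * p ^ h + pqNum p q h)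
        (fun h => pqNum p q h) n 0 := by
  rw [← histSum_lin, ← sum_eq_histSum linAllowed linNext _ linCode
    (fun σ => linGaps σ n) linGaps_zero
    linGaps_last linCode_mem linGaps_succ_eq_next linCode_injective]
  · exact Finset.sum_congr rfl fun σ _ => lin_weight_eq_prod p q w y σ
  · rw [histSum_lin_card, Fintype.card_perm, Fintype.card_fin]

end Linear

/-! ### Changing the weights and extracting coefficients -/

section Expansion

variable {n : ℕ}

/-- There are `cval + cda` excedances, and `σ` carries the drops onto the `cval + cdd` points with
`x < σ.symm x`; the remaining points are fixed. -/
theorem add_two_mul_eq (σ : Equiv.Perm (Fin n)) :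
    fix σ + 2 * cvalley σ + cda σ + cdd σ = n := by
  have h1 := card_filter_disjoint (Finset.univ : Finset (Fin n))
    (fun x => σ.symm x > x ∧ x < σ x) (fun x => σ.symm x < x ∧ x < σ x) (fun x => x < σ x)
    (fun x _ => by have := symm_apply_eq_self_iff σ x; grind) (fun x _ => by grind)
  have h2 := card_filter_disjoint (Finset.univ : Finset (Fin n))
    (fun x => σ.symm x > x ∧ x < σ x) (fun x => σ.symm x > x ∧ x > σ x) (fun x => x < σ.symm x)
    (fun x _ => by have := symm_apply_eq_self_iff σ x; grind) (fun x _ => by grind)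
  have h3 := card_filter_disjoint (Finset.univ : Finset (Fin n))
    (fun x => x < σ x) (fun x => σ x < x) (fun x => ¬ σ x = x)
    (fun x _ => by grind) (fun x _ => by grind)
  have h4 := Finset.card_filter_add_card_filter_not (s := (Finset.univ : Finset (Fin n)))
    (fun x => σ x = x)
  have h5 : (Finset.univ.filter fun x : Fin n => σ x < x).card =
      (Finset.univ.filter fun x : Fin n => x < σ.symm x).card := by
    simp only [Finset.card_filter]
    rw [← Equiv.sum_comp σ fun x => if x < σ.symm x then 1 else 0]
    simp
  rw [Finset.card_univ, Fintype.card_fin] at h4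
  unfold fix cvalley cda cdd
  omega

theorem coeff_coeff_monomial {S : Type*} [CommRing S] (x z : S) (m l c d k j : ℕ) :
    (((Polynomial.C (Polynomial.C x) ^ m * Polynomial.C (Polynomial.C z) ^ l *
      Polynomial.C Polynomial.X ^ c * Polynomial.X ^ d :
        Polynomial (Polynomial S)).coeff j).coeff k) =
      if c = k ∧ d = j then x ^ m * z ^ l else 0 := by
  simp only [← Polynomial.C_pow, ← Polynomial.C_mul, Polynomial.coeff_C_mul,
    Polynomial.coeff_X_pow]
  by_cases hj : j = d
  · by_cases hk : k = c
    · rw [if_pos hj, if_pos ⟨hk.symm, hj.symm⟩, mul_one, Polynomial.coeff_C_mul,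
        Polynomial.coeff_X_pow, if_pos hk, mul_one]
    · rw [if_pos hj, if_neg fun h => hk h.1.symm, mul_one, Polynomial.coeff_C_mul,
        Polynomial.coeff_X_pow, if_neg hk, mul_zero]
  · rw [if_neg hj, if_neg fun h => hj h.2.symm, mul_zero, Polynomial.coeff_zero]

theorem b_eq_sum_cyclicClass (n k j : ℕ) :
    b n k j = ∑ σ ∈ cyclicClass n k j,
      MvPolynomial.X 0 ^ nest σ * MvPolynomial.X 1 ^ cros σ := by
  rw [b, B, Polynomial.finsetSum_coeff, Polynomial.finsetSum_coeff, cyclicClass,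
    Finset.sum_filter]
  refine Finset.sum_congr rfl fun σ _ => ?_
  by_cases hc : cda σ = 0
  · simp only [hc, one_pow, pow_zero, mul_one, coeff_coeff_monomial, and_true]
  · simp [hc]

theorem aeval_b {R : Type*} [CommRing R] (p q : R) (n k j : ℕ) :
    MvPolynomial.aeval ![p, q] (b n k j) =
      ∑ σ ∈ cyclicClass n k j, p ^ nest σ * q ^ cros σ := by
  rw [b_eq_sum_cyclicClass, map_sum]
  simp

theorem coeff_b_nonneg (n k j : ℕ) (m : Fin 2 →₀ ℕ) : 0 ≤ MvPolynomial.coeff m (b n k j) := by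
  rw [b_eq_sum_cyclicClass, MvPolynomial.coeff_sum]
  refine Finset.sum_nonneg fun σ _ => ?_
  rw [MvPolynomial.X_pow_eq_monomial, MvPolynomial.X_pow_eq_monomial, MvPolynomial.monomial_mul,
    MvPolynomial.coeff_monomial]
  split_ifs <;> simp

/-- At `u = 0` only permutations without double excedance survive, and for these `n - j - 2 * k` is
the number of double drops. -/
theorem sum_aeval_b {R : Type*} [CommRing R] (n : ℕ) (p q y w s : R) :
    ∑ j ∈ Finset.range (n + 1), y ^ j * ∑ k ∈ Finset.range ((n - j) / 2 + 1),
      MvPolynomial.aeval ![p, q] (b n k j) * w ^ k * s ^ (n - j - 2 * k) =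
    B n p q 1 0 s w y := by
  have key : ∀ j k, y ^ j * (MvPolynomial.aeval ![p, q] (b n k j) * w ^ k *
      s ^ (n - j - 2 * k)) = ∑ σ : Equiv.Perm (Fin n), if k = cvalley σ then if j = fix σ then
        p ^ nest σ * q ^ cros σ * 1 ^ drop σ * 0 ^ cda σ * s ^ cdd σ * w ^ cvalley σ * y ^ fix σ
      else 0 else 0 := by
    intro j k
    rw [aeval_b, cyclicClass, Finset.sum_filter, Finset.sum_mul, Finset.sum_mul, Finset.mul_sum]
    refine Finset.sum_congr rfl fun σ _ => ?_
    by_cases hk : k = cvalley σ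
    · by_cases hj : j = fix σ
      · by_cases hc : cda σ = 0
        · have := add_two_mul_eq σ
          subst hk hj
          rw [show n - fix σ - 2 * cvalley σ = cdd σ by omega]
          simp only [hc, and_self, if_true, one_pow, pow_zero, mul_one]
          ring
        · simp [hc]
      · simp [hj, Ne.symm hj]
    · simp [hk, Ne.symm hk]
  simp only [Finset.mul_sum, key]
  rw [B]
  simp only [Finset.sum_comm (s := Finset.range _) (t := Finset.univ), Finset.sum_ite_eq',
    Finset.mem_range]
  refine Finset.sum_congr rfl fun σ _ => ?_
  have h := add_two_mul_eq σ
  rw [Finset.sum_eq_single (fix σ)]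
  · rw [if_pos (by omega), if_pos rfl]
  · intro j _ hj
    simp [hj]
  · intro hj
    rw [Finset.mem_range] at hj
    omega

/-- The gauge `t ^ h` moves the factor `t` from the down steps to the up steps. -/
theorem B_eq_B_gauge {R : Type*} [CommRing R] (n : ℕ) (p q t u v w y : R) :
    B n p q t u v w y = B n p q 1 0 (q * u + t * v) (t * w) y := by
  rw [B_eq_motzkin, B_eq_motzkin, motzkin_gauge _ _ _ (fun _ => t * w)
    (fun h => 1 * pqNum p q h ^ 2) (fun h => t ^ h)]
  · simp
  · simp
  · simp [pqNum_zero]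
  · simp [pqNum_zero]
  · intro h; ring
  · intro h; ring

/-- The gauge `[1][2]⋯[h]` moves one factor of `[h]^2` from the down steps to the up steps. -/
theorem B_eq_sum_lin {R : Type*} [CommRing R] (n : ℕ) (p q w y : R) :
    B n p q 1 0 1 w y = ∑ σ : Equiv.Perm (Fin n), if DoubleAscentsAreForemaxima σ then
      p ^ ress σ * q ^ les σ * w ^ valley σ * y ^ da σ else 0 := by
  rw [B_eq_motzkin, sum_lin_eq_motzkin, motzkin_gauge _ _ _
    (fun h => w * pqNum p q (h + 1)) (fun h => pqNum p q h)
    (fun h => ∏ i ∈ Finset.range h, pqNum p q (i + 1))]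
  · simp
  · simp
  · simp [pqNum_zero]
  · simp [pqNum_zero]
  · intro h
    rw [Finset.prod_range_succ]
    ring
  · intro h
    rw [Finset.prod_range_succ]
    ring

theorem b_eq_sum_linearClass (n k j : ℕ) :
    b n k j = ∑ σ ∈ linearClass n k j,
      MvPolynomial.X 0 ^ ress σ * MvPolynomial.X 1 ^ les σ := by
  rw [b, B_eq_sum_lin, Polynomial.finsetSum_coeff, Polynomial.finsetSum_coeff, linearClass,
    Finset.sum_filter]
  refine Finset.sum_congr rfl fun σ _ => ?_
  by_cases hc : DoubleAscentsAreForemaxima σ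
  · simp only [hc, if_true, coeff_coeff_monomial, and_true]
  · simp [hc]

theorem derangementClass_eq (n k : ℕ) : derangementClass n k = cyclicClass n k 0 := by
  ext σ
  have hd : σ ∈ derangements (Fin n) ↔ fix σ = 0 := by
    rw [fix, Finset.card_eq_zero, Finset.filter_eq_empty_iff]
    exact ⟨fun h x _ => h x, fun h x => h (Finset.mem_univ x)⟩
  simp only [derangementClass, cyclicClass, Finset.mem_filter, Finset.mem_univ, true_and, hd]
  tauto

theorem coderangementClass_eq (n k : ℕ) : coderangementClass n k = linearClass n k 0 := by
  ext σ
  simp only [coderangementClass, linearClass, Finset.mem_filter, Finset.mem_univ, true_and]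
  have h : da σ = 0 → DoubleAscentsAreForemaxima σ ∧ fmax σ = 0 := by
    intro h
    rw [da, Finset.card_eq_zero, Finset.filter_eq_empty_iff] at h
    refine ⟨fun i hi hd => absurd hd (h hi), ?_⟩
    rw [fmax, Finset.card_eq_zero, Finset.filter_eq_empty_iff]
    exact fun i hi hf => h hi hf.1
  tauto

end Expansion

end PermStat

/-! ### The theorem -/

theorem mainTheorem3 (n : ℕ) :
    (∀ {R : Type*} [CommRing R] (p q t u v w y : R),
      PermStat.B n p q t u v w y =
        ∑ j ∈ Finset.range (n + 1), y ^ j *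
          ∑ k ∈ Finset.range ((n - j) / 2 + 1),
            MvPolynomial.aeval ![p, q] (PermStat.b n k j) * (t * w) ^ k *
              (q * u + t * v) ^ (n - j - 2 * k)) ∧
    (∀ k j : ℕ,
      (∀ m, 0 ≤ MvPolynomial.coeff m (PermStat.b n k j)) ∧
      PermStat.b n k j = ∑ σ ∈ PermStat.cyclicClass n k j,
        MvPolynomial.X 0 ^ PermStat.nest σ * MvPolynomial.X 1 ^ PermStat.cros σ ∧
      PermStat.b n k j = ∑ σ ∈ PermStat.linearClass n k j,
        MvPolynomial.X 0 ^ PermStat.ress σ * MvPolynomial.X 1 ^ PermStat.les σ) ∧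
    (∀ k : ℕ,
      PermStat.b n k 0 = ∑ σ ∈ PermStat.derangementClass n k,
        MvPolynomial.X 0 ^ PermStat.nest σ * MvPolynomial.X 1 ^ PermStat.cros σ ∧
      PermStat.b n k 0 = ∑ σ ∈ PermStat.coderangementClass n k,
        MvPolynomial.X 0 ^ PermStat.ress σ * MvPolynomial.X 1 ^ PermStat.les σ) := by
  refine ⟨fun p q t u v w y => ?_, fun k j => ⟨PermStat.coeff_b_nonneg n k j,
    PermStat.b_eq_sum_cyclicClass n k j, PermStat.b_eq_sum_linearClass n k j⟩, fun k => ⟨?_, ?_⟩⟩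
  · rw [PermStat.sum_aeval_b, PermStat.B_eq_B_gauge]
  · rw [PermStat.derangementClass_eq, PermStat.b_eq_sum_cyclicClass]
  · rw [PermStat.coderangementClass_eq, PermStat.b_eq_sum_linearClass]
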